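/- **Theorem 3.4.** For a real polynomial $p$, let $N(p;\mathbb C\setminus[0,\infty))$ denote the number of complex zeros of $p$ outside $[0,\infty)$, counted with multiplicity (and $0$ if $p\equiv 0$). Let $\langle f_n\rangle$ be a sequence of real polynomials which converges weakly to a formal power series $f$, that is, for every integer $k\ge 0$ the $k$-th coefficient of $f$ is $\frac1{k!}\lim_{n\to\infty}f_n^{(k)}(0)$ (the limits being assumed to exist). Suppose that some coefficient of $f$ is nonzero and that the sequence $\langle N(f_n;\mathbb C\setminus[0,\infty))\rangle$ is bounded. Then $f$ has infinite radius of convergence, the entire function it represents belongs to $\mathcal{LP}(S_0)^*$, and $f_n\to f$ uniformly on compact subsets of $\mathbb C$. Here $S_0=[0,\infty)$, a real entire function is an entire function that maps $\mathbb R$ into $\mathbb R$, $\mathcal{LP}(S_0)$ is the class of real entire functions of the form $$g(z)=c\,z^m e^{-\alpha z}\prod_j\left(1-\frac{z}{a_j}\right)\qquad(z\in\mathbb C)$$ with $c\in\mathbb R$, $m$ a nonnegative integer, $\alpha\ge 0$, $a_1,a_2,\dots>0$ (finitely many, possibly none, or infinitely many) and $\sum_j a_j^{-1}<\infty$, and $\mathcal{LP}(S_0)^*$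 is the class of real entire functions of the form $Pg$ with $P$ a real polynomial and $g\in\mathcal{LP}(S_0)$. -/

import Mathlib

open Filter Topology Polynomial

/-- The closed half line `S₀ = [0, ∞)`, as a subset of the complex plane. -/
def halfLine : Set ℂ := {z : ℂ | 0 ≤ z.re ∧ z.im = 0}

open Classical in
/-- `N(p; X)`: the number of complex zeros of the real polynomial `p` that lie in `X`, counted
according to their multiplicities; it is `0` if `p` is the zero polynomial (`Polynomial.aroots` is
then the empty multiset). -/
noncomputable def zeroCount (p : ℝ[X]) (X : Set ℂ) : ℕ :=
  (p.aroots ℂ).countP (fun z => z ∈ X)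

/-- A real polynomial as a function on the complex plane. -/
noncomputable def polyFun (p : ℝ[X]) : ℂ → ℂ := fun z => aeval z p

/-- Weak convergence of a sequence of functions (analytic at `0`) to a formal power series: for
every `k` the numbers `f n ^ (k) (0) / k!` converge to the `k`-th coefficient. -/
def ConvergesWeakly (f : ℕ → ℂ → ℂ) (g : PowerSeries ℂ) : Prop :=
  ∀ k : ℕ, Tendsto (fun n => 1 / (k.factorial : ℂ) * iteratedDeriv k (f n) 0) atTop
    (𝓝 (PowerSeries.coeff k g))

/-- Strong convergence: uniform convergence on the compact subsets of the complex plane. -/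
def ConvergesStrongly (f : ℕ → ℂ → ℂ) (g : ℂ → ℂ) : Prop :=
  ∀ K : Set ℂ, IsCompact K → TendstoUniformlyOn f g atTop K

/-- The formal power series `g` has infinite radius of convergence and its sum is `F`. -/
def Represents (g : PowerSeries ℂ) (F : ℂ → ℂ) : Prop :=
  ∀ z : ℂ, HasSum (fun k : ℕ => PowerSeries.coeff k g * z ^ k) (F z)

/-- Real entire functions: entire functions that map the real line into itself. -/
def IsRealEntire (f : ℂ → ℂ) : Prop :=
  Differentiable ℂ f ∧ ∀ x : ℝ, (f x).im = 0

/-- The class `LP(S₀)`: the real entire functions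
`f z = c * z ^ m * exp (-α * z) * ∏ j, (1 - z / a j)` with `c` real, `m` a nonnegative integer,
`α ≥ 0`, all `a j > 0` and `∑ j, 1 / a j < ∞`. The family `a` may be empty, finite or infinite.
The summability makes the product absolutely convergent, see `multipliable_one_sub_div`. -/
def LPHalfLine : Set (ℂ → ℂ) :=
  {f | IsRealEntire f ∧
    ∃ (c : ℝ) (m : ℕ) (α : ℝ) (ι : Type) (_ : Countable ι) (a : ι → ℝ),
      0 ≤ α ∧ (∀ j, 0 < a j) ∧ Summable (fun j => (a j)⁻¹) ∧
      ∀ z : ℂ, f z = c * z ^ m * Complex.exp (-α * z) * ∏' j, (1 - z / a j)}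

/-- The class `LP(S₀)*`: the real entire functions `P * g` with `P` a real polynomial and `g` in
`LP(S₀)`. -/
def LPHalfLineStar : Set (ℂ → ℂ) :=
  {f | IsRealEntire f ∧ ∃ (P : ℝ[X]) (g : ℂ → ℂ), g ∈ LPHalfLine ∧
    ∀ z : ℂ, f z = polyFun P z * g z}

/-- The products in the definition of `LP(S₀)` converge, so that `∏'` has its intended value. -/
theorem multipliable_one_sub_div {ι : Type} {a : ι → ℝ} (ha : ∀ j, 0 < a j)
    (hs : Summable (fun j => (a j)⁻¹)) (z : ℂ) :
    Multipliable (fun j => 1 - z / (a j : ℂ)) := by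
  have h : Summable (fun j => ‖-(z / (a j : ℂ))‖) := by
    refine (hs.mul_left ‖z‖).congr fun j => ?_
    rw [norm_neg, norm_div, Complex.norm_real, Real.norm_of_nonneg (ha j).le, div_eq_mul_inv]
  simpa [sub_eq_add_neg] using multipliable_one_add_of_summable h

/-- A real polynomial with at most `B` roots outside `[0, ∞)`, in factored form. -/
def HasNonnegFactor (B : ℕ) (p : ℝ[X]) : Prop :=
  ∃ (s : Multiset ℝ) (Q : ℝ[X]), (∀ a ∈ s, 0 ≤ a) ∧ Q.natDegree ≤ B ∧
    p = (s.map fun a => X - C a).prod * Q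

theorem hasNonnegFactor_of_natDegree_le {B : ℕ} {p : ℝ[X]}
    (h : p.natDegree ≤ Multiset.card (p.roots.filter (0 ≤ ·)) + B) : HasNonnegFactor B p := by
  obtain ⟨q, hq, hdeg, -⟩ := p.exists_prod_multiset_X_sub_C_mul
  refine ⟨p.roots.filter (0 ≤ ·), ((p.roots.filter (¬ 0 ≤ ·)).map fun a => X - C a).prod * q,
    fun a ha => (Multiset.mem_filter.1 ha).2, ?_, ?_⟩
  · refine natDegree_mul_le.trans ?_
    rw [natDegree_multiset_prod_X_sub_C_eq_card]
    have := congrArg Multiset.card (Multiset.filter_add_not (fun x : ℝ => 0 ≤ x) p.roots)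
    rw [Multiset.card_add] at this
    omega
  · conv_lhs => rw [← hq, ← Multiset.filter_add_not (fun x : ℝ => 0 ≤ x) p.roots]
    rw [Multiset.map_add, Multiset.prod_add, mul_assoc]

theorem HasNonnegFactor.natDegree_le {B : ℕ} {p : ℝ[X]} (hp : p ≠ 0) (h : HasNonnegFactor B p) :
    p.natDegree ≤ Multiset.card (p.roots.filter (0 ≤ ·)) + B := by
  obtain ⟨s, Q, hs, hQ, rfl⟩ := h
  have h1 : s ≤ (((s.map fun a => X - C a).prod * Q).roots.filter (0 ≤ ·)) := by
    rw [Multiset.le_filter, roots_mul hp, roots_multiset_prod_X_sub_C]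
    exact ⟨Multiset.le_add_right _ _, hs⟩
  have h2 := Multiset.card_le_card h1
  refine natDegree_mul_le.trans ?_
  rw [natDegree_multiset_prod_X_sub_C_eq_card]
  omega

theorem hasNonnegFactor_of_zeroCount_le {B : ℕ} {p : ℝ[X]}
    (h : zeroCount p halfLineᶜ ≤ B) : HasNonnegFactor B p := by
  classical
  rcases eq_or_ne p 0 with rfl | hp
  · exact ⟨0, 0, by simp, by simp, by simp⟩
  apply hasNonnegFactor_of_natDegree_le
  obtain ⟨q, hq, hdeg, hroots⟩ := p.exists_prod_multiset_X_sub_C_mul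
  have hq0 : q ≠ 0 := by rintro rfl; exact hp (by rw [← hq, mul_zero])
  have hsplit : p.aroots ℂ = p.roots.map (fun a : ℝ => (a : ℂ)) + q.aroots ℂ := by
    conv_lhs => rw [← hq]
    rw [aroots_mul (by rwa [hq]), aroots_def, Polynomial.map_multiset_prod, Multiset.map_map]
    congr 1
    have : ((p.roots.map fun a => X - C a).map (Polynomial.map (algebraMap ℝ ℂ)))
        = (p.roots.map (fun a : ℝ => (a : ℂ))).map fun a => X - C a := by
      simp [Multiset.map_map]
    rw [← Multiset.map_map, this, roots_multiset_prod_X_sub_C]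
  have hqc : (q.aroots ℂ).countP (fun z => z ∈ halfLineᶜ) = q.natDegree := by
    rw [Multiset.countP_eq_card.2, ← IsAlgClosed.card_aroots_eq_natDegree (B := ℂ)]
    · intro z hz hz'
      have hzr : (z.re : ℂ) = z := Complex.ext rfl (by simpa using hz'.2.symm)
      have : z.re ∈ q.roots := by
        rw [mem_roots hq0, IsRoot.def]
        have h1 := (mem_aroots.1 hz).2
        rw [← hzr] at h1
        have h2 : aeval (z.re : ℂ) q = ((q.eval z.re : ℝ) : ℂ) := by
          simpa using aeval_algebraMap_apply ℂ z.re q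
        rw [h2] at h1
        exact_mod_cast h1
      simp [hroots] at this
  have hneg : (p.roots.map (fun a : ℝ => (a : ℂ))).countP (fun z => z ∈ halfLineᶜ)
      = Multiset.card (p.roots.filter (¬ 0 ≤ ·)) := by
    rw [Multiset.countP_map]
    simp [halfLine]
  have htot := congrArg Multiset.card (Multiset.filter_add_not (fun x : ℝ => 0 ≤ x) p.roots)
  rw [Multiset.card_add] at htot
  have hz : zeroCount p halfLineᶜ = Multiset.card (p.roots.filter (¬ 0 ≤ ·)) + q.natDegree := by
    rw [zeroCount, hsplit, Multiset.countP_add, ← hneg, ← hqc]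
    congr!
  omega

/-- Rolle's theorem, with multiplicities, for the nonnegative roots. -/
theorem card_filter_roots_le_derivative (p : ℝ[X]) :
    Multiset.card (p.roots.filter (0 ≤ ·)) ≤
      Multiset.card ((derivative p).roots.filter (0 ≤ ·)) + 1 := by
  rcases eq_or_ne (derivative p) 0 with hp' | hp'
  · rw [eq_C_of_derivative_eq_zero hp']
    simp
  have hp : p ≠ 0 := ne_of_apply_ne derivative (by rwa [derivative_zero])
  set r := p.roots.filter (0 ≤ ·) with hr
  set r' := (derivative p).roots.filter (0 ≤ ·) with hr'
  have hrolle : r.toFinset.card ≤ (r'.toFinset \ r.toFinset).card + 1 := by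
    refine Finset.card_le_sdiff_of_interleaved fun x hx y hy hxy _ => ?_
    rw [Multiset.mem_toFinset, hr, Multiset.mem_filter, mem_roots hp] at hx hy
    obtain ⟨z, hz1, hz2⟩ := exists_deriv_eq_zero hxy p.continuousOn (hx.1.trans hy.1.symm)
    refine ⟨z, ?_, hz1⟩
    rw [Multiset.mem_toFinset, hr', Multiset.mem_filter, mem_roots hp', IsRoot, ← p.deriv]
    exact ⟨hz2, hx.2.trans hz1.1.le⟩
  have hmult : ∀ x ∈ r.toFinset, r.count x - 1 ≤ r'.count x := by
    intro x hx
    have hx0 : 0 ≤ x := (Multiset.mem_filter.1 (Multiset.mem_toFinset.1 hx)).2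
    rw [hr, hr', Multiset.count_filter_of_pos hx0, Multiset.count_filter_of_pos hx0,
      count_roots, count_roots]
    exact rootMultiplicity_sub_one_le_derivative_rootMultiplicity _ _
  calc
    Multiset.card r = ∑ x ∈ r.toFinset, r.count x := (Multiset.toFinset_sum_count_eq _).symm
    _ = ∑ x ∈ r.toFinset, (r.count x - 1 + 1) :=
      (Eq.symm <| Finset.sum_congr rfl fun _ hx => tsub_add_cancel_of_le <|
        Nat.succ_le_iff.2 <| Multiset.count_pos.2 <| Multiset.mem_toFinset.1 hx)
    _ = (∑ x ∈ r.toFinset, (r.count x - 1)) + r.toFinset.card := by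
      simp only [Finset.sum_add_distrib, Finset.card_eq_sum_ones]
    _ ≤ (∑ x ∈ r.toFinset, r'.count x) + ((r'.toFinset \ r.toFinset).card + 1) :=
      add_le_add (Finset.sum_le_sum hmult) hrolle
    _ ≤ (∑ x ∈ r.toFinset, r'.count x) + ((∑ x ∈ r'.toFinset \ r.toFinset, r'.count x) + 1) := by
      simp only [Finset.card_eq_sum_ones]
      gcongr with x hx
      rw [Nat.succ_le_iff, Multiset.count_pos, ← Multiset.mem_toFinset]
      exact (Finset.mem_sdiff.1 hx).1
    _ = Multiset.card r' + 1 := by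
      rw [← add_assoc, ← Finset.sum_union Finset.disjoint_sdiff, Finset.union_sdiff_self_eq_union, ←
        Multiset.toFinset_sum_count_eq, ← Finset.sum_subset Finset.subset_union_right]
      intro x _ hx₂
      simpa only [Multiset.mem_toFinset, Multiset.count_eq_zero] using hx₂

theorem HasNonnegFactor.derivative {B : ℕ} {p : ℝ[X]} (h : HasNonnegFactor B p) :
    HasNonnegFactor B (derivative p) := by
  rcases eq_or_ne (Polynomial.derivative p) 0 with hp' | hp'
  · rw [hp']; exact ⟨0, 0, by simp, by simp, by simp⟩
  have hp : p ≠ 0 := ne_of_apply_ne Polynomial.derivative (by rwa [derivative_zero])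
  apply hasNonnegFactor_of_natDegree_le
  have h1 := h.natDegree_le hp
  have h2 := card_filter_roots_le_derivative p
  have h3 : p.natDegree ≠ 0 := fun h0 => hp' (by
    rw [eq_C_of_natDegree_eq_zero h0, derivative_C])
  have h4 := natDegree_derivative_lt h3
  omega

theorem HasNonnegFactor.iterate_derivative {B : ℕ} {p : ℝ[X]} (h : HasNonnegFactor B p) (m : ℕ) :
    HasNonnegFactor B (Polynomial.derivative^[m] p) := by
  induction m with
  | zero => exact h
  | succ m ih => rw [Function.iterate_succ_apply']; exact ih.derivative

/-- The polynomial `∏ (1 - u X)`, `u` running over a multiset of complex numbers. -/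
noncomputable def recProd (U : Multiset ℂ) : ℂ[X] := (U.map fun u => 1 - C u * X).prod

theorem recProd_zero : recProd 0 = 1 := by simp [recProd]

theorem recProd_cons (u : ℂ) (U : Multiset ℂ) :
    recProd (u ::ₘ U) = (1 - C u * X) * recProd U := by simp [recProd]

theorem recProd_add (U V : Multiset ℂ) : recProd (U + V) = recProd U * recProd V := by
  simp [recProd]

theorem coeff_zero_recProd (U : Multiset ℂ) : (recProd U).coeff 0 = 1 := by
  induction U using Multiset.induction_on with
  | empty => simp [recProd_zero]
  | cons u U ih => simp [recProd_cons, mul_coeff_zero, ih]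

theorem derivative_coe_recProd (U : Multiset ℂ) :
    PowerSeries.derivative ℂ (recProd U : PowerSeries ℂ) =
      -(recProd U * PowerSeries.mk fun k => (U.map (· ^ (k + 1))).sum) := by
  induction U using Multiset.induction_on with
  | empty =>
    have : (PowerSeries.mk fun k => ((0 : Multiset ℂ).map (· ^ (k + 1))).sum) = 0 := by
      ext; simp
    rw [this, recProd_zero]; simp
  | cons u U ih =>
    have hsplit : (PowerSeries.mk fun k => ((u ::ₘ U).map (· ^ (k + 1))).sum) =
        PowerSeries.mk (fun k => u ^ (k + 1)) +
          PowerSeries.mk fun k => (U.map (· ^ (k + 1))).sum := by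
      ext; simp
    have hgeom : (1 - PowerSeries.C u * PowerSeries.X) * PowerSeries.mk (fun k => u ^ (k + 1)) =
        PowerSeries.C u := by
      ext k
      rw [sub_mul, one_mul, mul_assoc, map_sub, PowerSeries.coeff_C_mul]
      cases k with
      | zero => simp
      | succ k =>
        rw [PowerSeries.coeff_succ_X_mul, PowerSeries.coeff_C]
        simp [pow_succ']
    rw [hsplit, recProd_cons, Polynomial.coe_mul, Derivation.leibniz, ih]
    simp only [Polynomial.coe_sub, Polynomial.coe_one, Polynomial.coe_mul, Polynomial.coe_C,
      Polynomial.coe_X, map_sub, Derivation.leibniz, smul_eq_mul, PowerSeries.derivative_X,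
      PowerSeries.derivative_C, PowerSeries.derivative_one]
    linear_combination (recProd U : PowerSeries ℂ) * hgeom

theorem newton_recProd (U : Multiset ℂ) (k : ℕ) :
    (U.map (· ^ (k + 1))).sum = -((recProd U).coeff (k + 1) * (k + 1)) -
      ∑ i ∈ Finset.range k, (recProd U).coeff (i + 1) * (U.map (· ^ (k - (i + 1) + 1))).sum := by
  have h := congrArg (PowerSeries.coeff k) (derivative_coe_recProd U)
  rw [PowerSeries.coeff_derivative, map_neg, PowerSeries.coeff_mul,
    Finset.Nat.sum_antidiagonal_eq_sum_range_succ_mk, Finset.sum_range_succ'] at h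
  simp only [Polynomial.coeff_coe, PowerSeries.coeff_mk, coeff_zero_recProd, Nat.sub_zero] at h
  linear_combination h

theorem exists_bound_power_sum (c : ℕ → ℝ) (k : ℕ) : ∃ D : ℝ, ∀ U : Multiset ℂ,
    (∀ i, ‖(recProd U).coeff i‖ ≤ c i) → ‖(U.map (· ^ (k + 1))).sum‖ ≤ D := by
  induction k using Nat.strong_induction_on with
  | _ k ih =>
    choose! D hD using ih
    refine ⟨c (k + 1) * (k + 1) + ∑ i ∈ Finset.range k, c (i + 1) * D (k - (i + 1)),
      fun U hU => ?_⟩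
    rw [newton_recProd]
    refine (norm_sub_le _ _).trans (add_le_add ?_ ((norm_sum_le _ _).trans
      (Finset.sum_le_sum fun i hi => ?_)))
    · rw [norm_neg, norm_mul]
      have : ‖((k : ℂ) + 1)‖ = k + 1 := by exact_mod_cast Complex.norm_natCast (k + 1)
      rw [this]
      gcongr
      exact hU _
    · rw [norm_mul]
      have hik := Finset.mem_range.1 hi
      exact mul_le_mul (hU _) (hD _ (by omega) U hU) (norm_nonneg _) ((norm_nonneg _).trans (hU _))

theorem norm_coeff_recProd_le (U : Multiset ℂ) (k : ℕ) :
    ‖(recProd U).coeff k‖ ≤ (U.map (‖·‖)).sum ^ k / k.factorial := by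
  induction U using Multiset.induction_on generalizing k with
  | empty =>
    rw [recProd_zero, coeff_one]
    rcases k with _ | k <;> simp
  | cons u U ih =>
    have hT : 0 ≤ (U.map (‖·‖)).sum := Multiset.sum_nonneg (by simp)
    rw [recProd_cons, Multiset.map_cons, Multiset.sum_cons]
    set T := (U.map (‖·‖)).sum
    cases k with
    | zero => simp [mul_coeff_zero, coeff_zero_recProd]
    | succ k =>
      rw [sub_mul, one_mul, mul_assoc, coeff_sub, coeff_C_mul, coeff_X_mul]
      refine (norm_sub_le _ _).trans ?_
      rw [norm_mul]
      have hpow : T ^ (k + 1) + (k + 1) * ‖u‖ * T ^ k ≤ (‖u‖ + T) ^ (k + 1) := by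
        clear ih
        induction k with
        | zero => simp; linarith
        | succ k ih =>
          have h0 : 0 ≤ (k + 1) * ‖u‖ * T ^ k := by positivity
          rw [pow_succ (‖u‖ + T)]
          refine le_trans ?_ (mul_le_mul_of_nonneg_right ih (by positivity))
          push_cast
          have h1 : (T ^ (k + 1) + (k + 1) * ‖u‖ * T ^ k) * (‖u‖ + T) =
              T ^ (k + 1 + 1) + (k + 1 + 1) * ‖u‖ * T ^ (k + 1) + (k + 1) * ‖u‖ * T ^ k * ‖u‖ := by
            ring
          linarith [mul_nonneg h0 (norm_nonneg u)]
      calc ‖(recProd U).coeff (k + 1)‖ + ‖u‖ * ‖(recProd U).coeff k‖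
          ≤ T ^ (k + 1) / (k + 1).factorial + ‖u‖ * (T ^ k / k.factorial) := by
            gcongr
            · exact ih _
            · exact ih _
        _ = (T ^ (k + 1) + (k + 1) * ‖u‖ * T ^ k) / (k + 1).factorial := by
            rw [Nat.factorial_succ]
            have : (k.factorial : ℝ) ≠ 0 := by positivity
            push_cast
            field_simp
        _ ≤ _ := by gcongr

/-- Simultaneous Dirichlet approximation. -/
theorem exists_simultaneous_approx (B : ℕ) : ∀ ε : ℝ, 0 < ε → ∃ K : ℕ, ∀ s : Multiset ℝ,
    Multiset.card s ≤ B → ∃ k : ℕ, k < K ∧ ∀ θ ∈ s, ∃ m : ℤ, |(k + 1) * θ - m| ≤ ε := by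
  induction B with
  | zero =>
    intro ε _
    refine ⟨1, fun s hs => ⟨0, one_pos, fun θ hθ => ?_⟩⟩
    rw [Multiset.card_eq_zero.1 (Nat.le_zero.1 hs)] at hθ
    simp at hθ
  | succ B ih =>
    intro ε hε
    obtain ⟨N, hN⟩ := exists_nat_one_div_lt hε
    obtain ⟨K, hK⟩ := ih (ε / (N + 1)) (by positivity)
    refine ⟨(N + 1) * (K + 1), fun s hs => ?_⟩
    induction s using Multiset.induction_on with
    | empty => exact ⟨0, by positivity, by simp⟩
    | cons θ s _ =>
      obtain ⟨k, hk, hks⟩ := hK s (by simpa using hs)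
      obtain ⟨j, hj0, hjN, hj⟩ := Real.exists_nat_abs_mul_sub_round_le ((k + 1) * θ)
        (Nat.succ_pos N)
      have hcast : (((j * (k + 1) - 1 : ℕ) : ℝ) + 1) = j * (k + 1) := by
        rw [Nat.cast_sub (Nat.succ_le_of_lt (by positivity))]
        push_cast
        ring
      refine ⟨j * (k + 1) - 1, ?_, fun θ' hθ' => ?_⟩
      · have : j * (k + 1) ≤ (N + 1) * (K + 1) := Nat.mul_le_mul hjN (by omega)
        have : 0 < j * (k + 1) := by positivity
        omega
      · rw [hcast]
        rcases Multiset.mem_cons.1 hθ' with rfl | hθ'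
        · refine ⟨round ((j : ℝ) * ((k + 1) * θ')), ?_⟩
          rw [mul_assoc]
          refine hj.trans (le_trans ?_ hN.le)
          push_cast
          exact one_div_le_one_div_of_le (by positivity) (by linarith)
        · obtain ⟨m, hm⟩ := hks θ' hθ'
          refine ⟨j * m, ?_⟩
          have : (j : ℝ) * (k + 1) * θ' - ((j * m : ℤ) : ℝ) = j * ((k + 1) * θ' - m) := by
            push_cast; ring
          rw [this, abs_mul, Nat.abs_cast]
          have hjN' : (j : ℝ) ≤ N + 1 := by exact_mod_cast hjN
          calc (j : ℝ) * |(k + 1) * θ' - m| ≤ (N + 1) * (ε / (N + 1)) := by gcongr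
            _ = ε := by field_simp

theorem half_norm_pow_le_re (w : ℂ) (k : ℕ) (m : ℤ)
    (h : |(k + 1) * (w.arg / (2 * Real.pi)) - m| ≤ 1 / 6) :
    ‖w‖ ^ (k + 1) / 2 ≤ (w ^ (k + 1)).re := by
  have hpi := Real.pi_pos
  have hre : (w ^ (k + 1)).re = ‖w‖ ^ (k + 1) * Real.cos ((k + 1) * w.arg) := by
    conv_lhs => rw [← Complex.norm_mul_exp_arg_mul_I w]
    rw [mul_pow, ← Complex.exp_nat_mul, ← Complex.ofReal_pow, Complex.re_ofReal_mul]
    congr 1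
    rw [show ((k + 1 : ℕ) : ℂ) * (w.arg * Complex.I) = (((k + 1) * w.arg : ℝ) : ℂ) * Complex.I by
      push_cast; ring, Complex.exp_ofReal_mul_I_re]
  have hcos : 1 / 2 ≤ Real.cos ((k + 1) * w.arg) := by
    rw [← Real.cos_sub_int_mul_two_pi _ m, ← Real.cos_abs, ← Real.cos_pi_div_three]
    apply Real.cos_le_cos_of_nonneg_of_le_pi (abs_nonneg _) (by linarith)
    have : (k + 1) * w.arg - m * (2 * Real.pi) =
        ((k + 1) * (w.arg / (2 * Real.pi)) - m) * (2 * Real.pi) := by field_simp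
    rw [this, abs_mul, abs_of_pos (by positivity : 0 < 2 * Real.pi)]
    nlinarith
  rw [hre, div_eq_mul_one_div]
  gcongr

theorem sum_map_ofReal_pow (Y : Multiset ℝ) (k : ℕ) :
    ((Y.map (fun y : ℝ => (y : ℂ))).map (· ^ k)).sum = (((Y.map (· ^ k)).sum : ℝ) : ℂ) := by
  induction Y using Multiset.induction_on with
  | empty => simp
  | cons y Y ih =>
    simp only [Multiset.map_cons, Multiset.sum_cons, ih]
    push_cast; ring

/-- If the coefficients of `∏ (1 - u X)` are bounded and all but `B` of the `u` are nonnegative,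
then the sum of the `|u|` is bounded. -/
theorem exists_bound_sum_norm (B : ℕ) (c : ℕ → ℝ) : ∃ M : ℝ, ∀ (Y : Multiset ℝ) (W : Multiset ℂ),
    (∀ y ∈ Y, 0 ≤ y) → Multiset.card W ≤ B →
    (∀ k, ‖(recProd (Y.map (fun y : ℝ => (y : ℂ)) + W)).coeff k‖ ≤ c k) →
    Y.sum ≤ M ∧ (W.map (‖·‖)).sum ≤ M := by
  choose D hD using exists_bound_power_sum c
  obtain ⟨K, hK⟩ := exists_simultaneous_approx B (1 / 6) (by norm_num)
  set A : ℝ := 1 + 2 * ∑ k ∈ Finset.range K, |D k| with hA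
  have hA1 : 1 ≤ A := by
    have : 0 ≤ ∑ k ∈ Finset.range K, |D k| := Finset.sum_nonneg fun _ _ => abs_nonneg _
    linarith
  refine ⟨|D 0| + B * A, fun Y W hY hW hc => ?_⟩
  have hs : ∀ k, ((Y.map (· ^ (k + 1))).sum : ℝ) + (W.map fun w => (w ^ (k + 1)).re).sum ≤ D k := by
    intro k
    have h := (Complex.re_le_norm _).trans (hD k _ hc)
    rw [Multiset.map_add, Multiset.sum_add, sum_map_ofReal_pow, Complex.add_re,
      Complex.ofReal_re] at h
    rwa [← Complex.coe_reAddGroupHom, map_multiset_sum, Multiset.map_map] at h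
  have hwA : ∀ w ∈ W, ‖w‖ ≤ A := by
    obtain ⟨k, hk, hkW⟩ := hK (W.map fun w => w.arg / (2 * Real.pi)) (by simpa using hW)
    have hre : ∀ w ∈ W, ‖w‖ ^ (k + 1) / 2 ≤ (w ^ (k + 1)).re := fun w hw => by
      obtain ⟨m, hm⟩ := hkW _ (Multiset.mem_map_of_mem _ hw)
      exact half_norm_pow_le_re w k m hm
    intro w hw
    have h1 : ‖w‖ ^ (k + 1) / 2 ≤ D k := by
      have hYk : 0 ≤ (Y.map (· ^ (k + 1))).sum := Multiset.sum_nonneg fun x hx => by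
        obtain ⟨y, hy, rfl⟩ := Multiset.mem_map.1 hx
        exact pow_nonneg (hY y hy) _
      have hle : (w ^ (k + 1)).re ≤ (W.map fun w => (w ^ (k + 1)).re).sum := by
        refine Multiset.single_le_sum (fun x hx => ?_) _ (Multiset.mem_map_of_mem _ hw)
        obtain ⟨v, hv, rfl⟩ := Multiset.mem_map.1 hx
        exact le_trans (by positivity) (hre v hv)
      linarith [hs k, hre w hw]
    have h2 : |D k| ≤ ∑ k ∈ Finset.range K, |D k| :=
      Finset.single_le_sum (f := fun k => |D k|) (fun _ _ => abs_nonneg _) (Finset.mem_range.2 hk)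
    by_contra! hcon
    have h3 : ‖w‖ ≤ ‖w‖ ^ (k + 1) := le_self_pow₀ (hA1.trans hcon.le) (by omega)
    linarith [le_abs_self (D k)]
  have hWsum : (W.map (‖·‖)).sum ≤ B * A := by
    refine (Multiset.sum_le_card_nsmul _ A fun x hx => ?_).trans ?_
    · obtain ⟨v, hv, rfl⟩ := Multiset.mem_map.1 hx
      exact hwA v hv
    · rw [Multiset.card_map, nsmul_eq_mul]
      gcongr
  refine ⟨?_, hWsum.trans (by linarith [abs_nonneg (D 0)])⟩
  have h0 := hs 0
  simp only [zero_add, pow_one, Multiset.map_id'] at h0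
  have hneg : -(W.map (‖·‖)).sum ≤ (W.map fun w => w.re).sum := by
    rw [← Multiset.sum_map_neg', Multiset.map_map]
    exact Multiset.sum_map_le_sum_map _ _ fun w _ =>
      neg_le_of_abs_le (Complex.abs_re_le_norm w)
  linarith [le_abs_self (D 0)]

theorem prod_X_sub_C_eq_of_ne_zero {K : Type*} [Field K] (s : Multiset K) (hs : (0 : K) ∉ s) :
    (s.map fun a => X - C a).prod =
      C (s.map fun a => -a).prod * ((s.map fun a => a⁻¹).map fun y => 1 - C y * X).prod := by
  induction s using Multiset.induction_on with
  | empty => simp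
  | cons a s ih =>
    have ha : a ≠ 0 := fun h => hs (by simp [h])
    simp only [Multiset.map_cons, Multiset.prod_cons, ih fun h => hs (Multiset.mem_cons_of_mem h),
      C_mul, C_neg]
    have : C a * C a⁻¹ = (1 : K[X]) := by rw [← C_mul, mul_inv_cancel₀ ha, C_1]
    linear_combination -(X * C (s.map fun a => -a).prod *
      ((s.map fun a => a⁻¹).map fun y => 1 - C y * X).prod) * this

theorem exists_eq_C_mul_recProd {R : ℂ[X]} (hR : R.coeff 0 ≠ 0) :
    ∃ W : Multiset ℂ, Multiset.card W ≤ R.natDegree ∧ R = C (R.coeff 0) * recProd W := by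
  have hR0 : R ≠ 0 := by rintro rfl; simp at hR
  have h0 : (0 : ℂ) ∉ R.roots := fun h => hR (by
    rw [coeff_zero_eq_eval_zero]; exact (mem_roots hR0).1 h)
  refine ⟨R.roots.map fun a => a⁻¹, by simpa using R.card_roots', ?_⟩
  have h := (IsAlgClosed.splits R).eq_prod_roots
  rw [prod_X_sub_C_eq_of_ne_zero _ h0, ← mul_assoc, ← C_mul] at h
  have hc := congrArg (coeff · 0) h
  simp only [coeff_C_mul] at hc
  rw [← recProd, coeff_zero_recProd, mul_one] at hc
  rw [hc]
  exact h

theorem map_prod_one_sub (Y : Multiset ℝ) :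
    ((Y.map fun y => 1 - C y * X).prod).map (algebraMap ℝ ℂ) =
      recProd (Y.map fun y : ℝ => (y : ℂ)) := by
  induction Y using Multiset.induction_on with
  | empty => simp [recProd]
  | cons y Y ih =>
    rw [Multiset.map_cons, Multiset.prod_cons, Polynomial.map_mul, ih, Multiset.map_cons,
      recProd_cons]
    simp

theorem natDegree_map_algebraMap_complex (R : ℝ[X]) :
    (R.map (algebraMap ℝ ℂ)).natDegree = R.natDegree := natDegree_map _

/-- A polynomial whose roots are in `[t, ∞)` up to at most `B` exceptions, and whose coefficients
are controlled by the constant one, has a normalized factorization with explicit bounds. -/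
theorem exists_normalized_factorization (B : ℕ) (c : ℕ → ℝ) : ∃ M : ℝ, 0 ≤ M ∧
    ∀ (t : ℝ) (s : Multiset ℝ) (Q p : ℝ[X]), 0 ≤ t → (∀ a ∈ s, t ≤ a) → Q.natDegree ≤ B →
    p = (s.map fun a => X - C a).prod * Q → p.coeff 0 ≠ 0 →
    (∀ k, |p.coeff k| ≤ c k * |p.coeff 0|) →
    ∃ (Y : Multiset ℝ) (R : ℝ[X]), (∀ y ∈ Y, 0 ≤ y ∧ y * t ≤ 1) ∧ Y.sum ≤ M ∧ R.natDegree ≤ B ∧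
      p = (Y.map fun y => 1 - C y * X).prod * R ∧
      (∀ k, |R.coeff k| ≤ |p.coeff 0| * (M ^ k / k.factorial)) ∧
      (∀ k, |p.coeff k| ≤ |p.coeff 0| * (M ^ k / k.factorial)) := by
  obtain ⟨M, hM⟩ := exists_bound_sum_norm B c
  have hnorm : ∀ (r : ℝ[X]) (k : ℕ), ‖(r.map (algebraMap ℝ ℂ)).coeff k‖ = |r.coeff k| :=
    fun r k => by simp
  refine ⟨2 * |M|, by positivity, fun t s Q p ht hs hQ hp hp0 hc => ?_⟩
  have h0s : (0 : ℝ) ∉ s := fun h => hp0 (by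
    rw [hp, coeff_zero_eq_eval_zero, eval_mul, eval_multiset_prod, Multiset.map_map,
      Multiset.prod_eq_zero (Multiset.mem_map.2 ⟨0, h, by simp⟩), zero_mul])
  set Y := s.map fun a => a⁻¹
  set R := C (s.map fun a => -a).prod * Q with hR
  have hpR : p = (Y.map fun y => 1 - C y * X).prod * R := by
    rw [hp, prod_X_sub_C_eq_of_ne_zero s h0s, hR]; ring
  have hmapp : p.map (algebraMap ℝ ℂ) =
      recProd (Y.map fun y : ℝ => (y : ℂ)) * R.map (algebraMap ℝ ℂ) := by
    rw [hpR, Polynomial.map_mul, map_prod_one_sub]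
  have hR0 : (R.map (algebraMap ℝ ℂ)).coeff 0 = (p.coeff 0 : ℝ) := by
    have := congrArg (coeff · 0) hmapp
    simpa [mul_coeff_zero, coeff_zero_recProd] using this.symm
  obtain ⟨W, hW, hRW⟩ := exists_eq_C_mul_recProd (R := R.map (algebraMap ℝ ℂ)) (by
    rw [hR0]; exact_mod_cast hp0)
  rw [hR0] at hRW
  have hRdeg : R.natDegree ≤ B := (natDegree_C_mul_le _ _).trans hQ
  rw [natDegree_map_algebraMap_complex] at hW
  have hY0 : ∀ y ∈ Y, 0 ≤ y ∧ y * t ≤ 1 := fun y hy => by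
    obtain ⟨a, ha, rfl⟩ := Multiset.mem_map.1 hy
    have h1 := hs a ha
    have ha0 : 0 < a := lt_of_le_of_ne (ht.trans h1) fun h => h0s (h ▸ ha)
    exact ⟨by positivity, by rw [inv_mul_le_one₀ ha0]; exact h1⟩
  have hpU : p.map (algebraMap ℝ ℂ) =
      C ((p.coeff 0 : ℝ) : ℂ) * recProd (Y.map (fun y : ℝ => (y : ℂ)) + W) := by
    rw [hmapp, hRW, recProd_add]; ring
  have hpk : ∀ k, |p.coeff k| =
      |p.coeff 0| * ‖(recProd (Y.map (fun y : ℝ => (y : ℂ)) + W)).coeff k‖ := fun k => by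
    rw [← hnorm, hpU, coeff_C_mul, norm_mul, Complex.norm_real, Real.norm_eq_abs]
  have hpos : 0 < |p.coeff 0| := abs_pos.2 hp0
  obtain ⟨hYM, hWM⟩ := hM Y W (fun y hy => (hY0 y hy).1) (hW.trans hRdeg) fun k => by
    have := hc k
    rw [hpk, mul_comm] at this
    exact le_of_mul_le_mul_right this hpos
  have hMabs := le_abs_self M
  have hWnn : 0 ≤ (W.map (‖·‖)).sum := Multiset.sum_nonneg (by simp)
  have hYnn : 0 ≤ Y.sum := Multiset.sum_nonneg fun y hy => (hY0 y hy).1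
  have hYnorm : ((Y.map fun y : ℝ => (y : ℂ)).map (‖·‖)).sum = Y.sum := by
    rw [Multiset.map_map, Multiset.map_congr rfl (g := id) fun y hy => ?_, Multiset.map_id]
    simp [abs_of_nonneg (hY0 y hy).1]
  refine ⟨Y, R, hY0, by linarith [abs_nonneg M], hRdeg, hpR, fun k => ?_, fun k => ?_⟩
  · rw [← hnorm, hRW, coeff_C_mul, norm_mul, Complex.norm_real, Real.norm_eq_abs]
    gcongr
    refine (norm_coeff_recProd_le W k).trans ?_
    gcongr
    linarith [abs_nonneg M]
  · rw [hpk]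
    gcongr
    refine (norm_coeff_recProd_le _ k).trans ?_
    rw [Multiset.map_add, Multiset.sum_add, hYnorm]
    gcongr
    linarith

theorem exists_coeff_bound {B : ℕ} {f : ℕ → ℝ[X]} {b : ℕ → ℝ}
    (hf : ∀ n, HasNonnegFactor B (f n))
    (hb : ∀ k, Tendsto (fun n => (f n).coeff k) atTop (𝓝 (b k))) (hne : ∃ k, b k ≠ 0) :
    ∃ A T : ℝ, 0 ≤ A ∧ 0 ≤ T ∧ ∀ᶠ n in atTop, ∀ k,
      |(f n).coeff k| ≤ A * (T ^ k / k.factorial) := by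
  obtain ⟨m, hm⟩ := hne
  have hbdd : ∀ k, ∃ c, ∀ n, |(f n).coeff k| ≤ c := fun k => by
    obtain ⟨c, hc⟩ := (hb k).abs.bddAbove_range
    exact ⟨c, fun n => hc ⟨n, rfl⟩⟩
  choose c hc using hbdd
  have hc0 : ∀ k, 0 ≤ c k := fun k => (abs_nonneg _).trans (hc k 0)
  set p : ℕ → ℝ[X] := fun n => derivative^[m] (f n) with hp
  have hpc : ∀ n k, (p n).coeff k = (k + m).descFactorial m * (f n).coeff (k + m) := fun n k => by
    rw [hp, coeff_iterate_derivative, nsmul_eq_mul]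
  set d : ℕ → ℝ := fun k => (k + m).descFactorial m * c (k + m) with hd
  have hpd : ∀ n k, |(p n).coeff k| ≤ d k := fun n k => by
    rw [hpc, abs_mul, Nat.abs_cast]
    exact mul_le_mul_of_nonneg_left (hc _ _) (by positivity)
  set δ := |b m| / 2 with hδ
  have hδ0 : 0 < δ := by have := abs_pos.2 hm; positivity
  have hlow : ∀ᶠ n in atTop, δ ≤ |(p n).coeff 0| := by
    have h1 : ∀ᶠ n in atTop, δ < |(f n).coeff m| :=
      (hb m).abs.eventually (lt_mem_nhds (half_lt_self (abs_pos.2 hm)))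
    filter_upwards [h1] with n hn
    rw [hpc, zero_add, Nat.descFactorial_self, abs_mul, Nat.abs_cast]
    have : (1 : ℝ) ≤ m.factorial := by exact_mod_cast m.factorial_pos
    nlinarith
  obtain ⟨M, hM0, hM⟩ := exists_normalized_factorization B fun k => d k / δ
  have hd0 : ∀ k, 0 ≤ d k := fun k => mul_nonneg (by positivity) (hc0 _)
  set T := max M 1
  have hT1 : 1 ≤ T := le_max_right _ _
  have hsum0 : 0 ≤ ∑ i ∈ Finset.range m, c i * i.factorial :=
    Finset.sum_nonneg fun i _ => mul_nonneg (hc0 i) (by positivity)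
  refine ⟨d 0 + ∑ i ∈ Finset.range m, c i * i.factorial, T, add_nonneg (hd0 0) hsum0,
    by linarith, ?_⟩
  filter_upwards [hlow] with n hn k
  rcases lt_or_ge k m with hkm | hkm
  · have h1 : c k * k.factorial ≤ ∑ i ∈ Finset.range m, c i * i.factorial :=
      Finset.single_le_sum (f := fun i => c i * (i.factorial : ℝ))
        (fun i _ => mul_nonneg (hc0 i) (by positivity)) (Finset.mem_range.2 hkm)
    have h2 : 1 ≤ T ^ k := one_le_pow₀ hT1
    have h3 : (0 : ℝ) < k.factorial := by positivity
    calc |(f n).coeff k| ≤ c k := hc k n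
      _ = c k * k.factorial * (1 / k.factorial) := by field_simp
      _ ≤ (d 0 + ∑ i ∈ Finset.range m, c i * i.factorial) * (T ^ k / k.factorial) := by
        exact mul_le_mul (by linarith [hd0 0]) (by gcongr) (by positivity)
          (add_nonneg (hd0 0) hsum0)
  · obtain ⟨j, rfl⟩ := Nat.exists_eq_add_of_le' hkm
    obtain ⟨s, Q, hs, hQ, hpQ⟩ := (hf n).iterate_derivative m
    obtain ⟨-, -, -, -, -, -, -, hbound⟩ := hM 0 s Q (p n) le_rfl hs hQ hpQ
      (abs_pos.1 (hδ0.trans_le hn)) fun k => by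
        refine (hpd n k).trans ?_
        rw [div_mul_eq_mul_div, le_div_iff₀ hδ0]
        exact mul_le_mul_of_nonneg_left hn (hd0 k)
    have h1 := hbound j
    rw [hpc, abs_mul, Nat.abs_cast] at h1
    have hfac : ((j + m).descFactorial m : ℝ) * j.factorial = (j + m).factorial := by
      have := Nat.factorial_mul_descFactorial (n := j + m) (k := m) (by omega)
      rw [Nat.add_sub_cancel] at this
      rw [mul_comm]
      exact_mod_cast this
    have hj : (0 : ℝ) < j.factorial := by positivity
    have hjm : (0 : ℝ) < (j + m).factorial := by positivity
    have h2 : |(f n).coeff (j + m)| * (j + m).factorial ≤ |(p n).coeff 0| * M ^ j := by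
      rw [← hfac]
      calc _ = ((j + m).descFactorial m * |(f n).coeff (j + m)|) * j.factorial := by ring
        _ ≤ |(p n).coeff 0| * (M ^ j / j.factorial) * j.factorial := by gcongr
        _ = _ := by field_simp
    rw [← mul_div_assoc, le_div_iff₀ hjm]
    refine h2.trans ?_
    have h3 : M ^ j ≤ T ^ (j + m) := (pow_le_pow_left₀ hM0 (le_max_left _ _) j).trans
      (pow_le_pow_right₀ hT1 (by omega))
    calc |(p n).coeff 0| * M ^ j ≤ d 0 * T ^ (j + m) := by
          gcongr
          exacts [hd0 0, hpd n 0]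
      _ ≤ _ := by
          gcongr
          linarith

theorem iteratedDeriv_polyFun (p : ℝ[X]) (k : ℕ) :
    iteratedDeriv k (polyFun p) = polyFun (derivative^[k] p) := by
  induction k with
  | zero => simp
  | succ k ih =>
    rw [iteratedDeriv_succ, ih, Function.iterate_succ_apply']
    ext z
    exact Polynomial.deriv_aeval _

theorem inv_factorial_mul_iteratedDeriv_polyFun (p : ℝ[X]) (k : ℕ) :
    1 / (k.factorial : ℂ) * iteratedDeriv k (polyFun p) 0 = (p.coeff k : ℂ) := by
  have hk : (k.factorial : ℂ) ≠ 0 := by exact_mod_cast k.factorial_ne_zero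
  rw [iteratedDeriv_polyFun, polyFun, ← coeff_zero_eq_aeval_zero', coeff_iterate_derivative]
  simp [Nat.descFactorial_self]
  field_simp

theorem hasSum_polyFun (p : ℝ[X]) (z : ℂ) :
    HasSum (fun k => (p.coeff k : ℂ) * z ^ k) (polyFun p z) := by
  rw [polyFun, aeval_eq_sum_range]
  simp only [Complex.real_smul]
  refine hasSum_sum_of_ne_finset_zero fun k hk => ?_
  rw [coeff_eq_zero_of_natDegree_lt (by simpa using hk)]
  simp

theorem summable_coeff_bound (A T ρ : ℝ) :
    Summable fun k : ℕ => A * (T ^ k / k.factorial) * ρ ^ k := by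
  refine ((Real.summable_pow_div_factorial (T * ρ)).mul_left A).congr fun k => ?_
  rw [mul_pow]; ring

theorem summable_of_coeff_bound {b : ℕ → ℝ} {A T : ℝ}
    (hb : ∀ k, |b k| ≤ A * (T ^ k / k.factorial)) (z : ℂ) :
    Summable fun k => (b k : ℂ) * z ^ k := by
  refine (summable_coeff_bound A T ‖z‖).of_norm_bounded fun k => ?_
  rw [norm_mul, norm_pow, Complex.norm_real, Real.norm_eq_abs]
  exact mul_le_mul_of_nonneg_right (hb k) (by positivity)

theorem convergesStrongly_of_coeff_bound {f : ℕ → ℝ[X]} {b : ℕ → ℝ} {A T : ℝ}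
    (hb : ∀ k, Tendsto (fun n => (f n).coeff k) atTop (𝓝 (b k)))
    (hA : ∀ᶠ n in atTop, ∀ k, |(f n).coeff k| ≤ A * (T ^ k / k.factorial)) :
    ConvergesStrongly (fun n => polyFun (f n)) fun z => ∑' k, (b k : ℂ) * z ^ k := by
  have hbA : ∀ k, |b k| ≤ A * (T ^ k / k.factorial) := fun k =>
    le_of_tendsto (hb k).abs (hA.mono fun n hn => hn k)
  intro K hK
  obtain ⟨ρ, hρ⟩ := hK.isBounded.subset_closedBall (0 : ℂ)
  set r := max ρ 0
  have hr : 0 ≤ r := le_max_right _ _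
  have hlim : Tendsto (fun n => ∑' k, |(f n).coeff k - b k| * r ^ k) atTop
      (𝓝 (∑' k : ℕ, |b k - b k| * r ^ k)) := by
    refine tendsto_tsum_of_dominated_convergence (summable_coeff_bound (2 * A) T r)
      (fun k => (((hb k).sub_const _).abs).mul_const _) (hA.mono fun n hn k => ?_)
    rw [Real.norm_of_nonneg (by positivity)]
    gcongr
    linarith [abs_sub (f n |>.coeff k) (b k), hn k, hbA k]
  simp only [sub_self, abs_zero, zero_mul, tsum_zero] at hlim
  rw [Metric.tendstoUniformlyOn_iff]
  intro ε hε
  filter_upwards [hA, hlim.eventually (gt_mem_nhds hε)] with n hn hnε z hz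
  have hzr : ‖z‖ ≤ r := (mem_closedBall_zero_iff.1 (hρ hz)).trans (le_max_left _ _)
  have hs : Summable fun k => |(f n).coeff k - b k| * r ^ k := by
    refine (summable_coeff_bound (2 * A) T r).of_nonneg_of_le (fun k => by positivity) fun k => ?_
    gcongr
    linarith [abs_sub (f n |>.coeff k) (b k), hn k, hbA k]
  have hdiff := (hasSum_polyFun (f n) z).sub (summable_of_coeff_bound hbA z).hasSum
  rw [dist_comm, dist_eq_norm, ← hdiff.tsum_eq]
  refine lt_of_le_of_lt (tsum_of_norm_bounded hs.hasSum fun k => ?_) hnε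
  rw [← sub_mul, norm_mul, norm_pow, ← Complex.ofReal_sub, Complex.norm_real, Real.norm_eq_abs]
  gcongr

@[to_additive]
theorem prod_range_getD {M : Type*} [CommMonoid M] (l : List ℝ) (f : ℝ → M) :
    ∏ j ∈ Finset.range l.length, f (l.getD j 0) = (l.map f).prod := by
  induction l with
  | nil => simp
  | cons a l ih => simp [Finset.prod_range_succ', ← ih, mul_comm]

/-- A finite multiset of nonnegative reals, enumerated in decreasing order and padded by zeros. -/
theorem exists_antitone_enumeration (Y : Multiset ℝ) (hY : ∀ y ∈ Y, 0 ≤ y) :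
    ∃ y : ℕ → ℝ, Antitone y ∧ (∀ j, 0 ≤ y j) ∧ (∀ j, y j = 0 ∨ y j ∈ Y) ∧
      ∃ N, (∀ j, N ≤ j → y j = 0) ∧ ∑ j ∈ Finset.range N, y j = Y.sum ∧
        ∀ f : ℝ → ℂ, ∏ j ∈ Finset.range N, f (y j) = (Y.map f).prod := by
  obtain ⟨l, hl, hs⟩ : ∃ l : List ℝ, (l : Multiset ℝ) = Y ∧ l.Pairwise (· ≥ ·) :=
    ⟨Y.sort (· ≥ ·), Multiset.sort_eq _ _, Multiset.pairwise_sort _ _⟩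
  have hmem : ∀ j, l.getD j 0 = 0 ∨ l.getD j 0 ∈ Y := fun j => by
    rcases lt_or_ge j l.length with h | h
    · right
      rw [List.getD_eq_getElem _ _ h, ← hl]
      exact Multiset.mem_coe.2 (List.getElem_mem h)
    · left
      exact List.getD_eq_default _ _ h
  have hnn : ∀ j, 0 ≤ l.getD j 0 := fun j => (hmem j).elim (fun h => h.ge) (hY _)
  refine ⟨fun j => l.getD j 0, fun i j hij => ?_, hnn, hmem, l.length,
    fun j hj => List.getD_eq_default _ _ hj, ?_, fun f => ?_⟩
  · rcases lt_or_ge j l.length with h | h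
    · rcases hij.eq_or_lt with rfl | hij
      · exact le_rfl
      · simp only [List.getD_eq_getElem _ _ h, List.getD_eq_getElem _ _ (hij.trans h)]
        exact List.pairwise_iff_getElem.1 hs i j _ _ hij
    · simp only [List.getD_eq_default _ _ h]
      exact hnn i
  · simpa [← hl] using sum_range_getD l id
  · rw [prod_range_getD l f, ← hl, Multiset.map_coe, Multiset.prod_coe]

theorem le_div_of_antitone {y : ℕ → ℝ} {M : ℝ} (hy : Antitone y)
    (hM : ∀ N, ∑ j ∈ Finset.range N, y j ≤ M) (j : ℕ) : y j ≤ M / (j + 1) := by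
  rw [le_div_iff₀ (by positivity)]
  refine le_trans ?_ (hM (j + 1))
  have := Finset.card_nsmul_le_sum (Finset.range (j + 1)) y (y j)
    fun i hi => hy (Nat.lt_succ_iff.1 (Finset.mem_range.1 hi))
  simpa [mul_comm] using this

/-- The Weierstrass factor of genus one is `1 + O(u ^ 2)`. -/
theorem norm_one_sub_mul_exp_sub_one_le (u : ℂ) :
    ‖(1 - u) * Complex.exp u - 1‖ ≤ 3 * Real.exp ‖u‖ * ‖u‖ ^ 2 := by
  have he : 1 ≤ Real.exp ‖u‖ := Real.one_le_exp (norm_nonneg _)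
  rcases le_total ‖u‖ 1 with h | h
  · have h1 := Complex.norm_exp_sub_one_sub_id_le h
    have h2 := Complex.norm_exp_sub_one_le h
    have h3 : (1 - u) * Complex.exp u - 1 =
        (Complex.exp u - 1 - u) - u * (Complex.exp u - 1) := by ring
    rw [h3]
    refine (norm_sub_le _ _).trans ?_
    rw [norm_mul]
    nlinarith [norm_nonneg u, sq_nonneg ‖u‖, mul_le_mul_of_nonneg_left h2 (norm_nonneg u)]
  · have h1 : ‖(1 - u) * Complex.exp u - 1‖ ≤ (1 + ‖u‖) * Real.exp ‖u‖ + 1 := by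
      refine (norm_sub_le _ _).trans ?_
      rw [norm_mul, norm_one]
      gcongr
      · exact (norm_sub_le _ _).trans (by rw [norm_one])
      · exact Complex.norm_exp_le_exp_norm u
    have h2 : ‖u‖ ≤ ‖u‖ ^ 2 := le_self_pow₀ h two_ne_zero
    calc ‖(1 - u) * Complex.exp u - 1‖ ≤ (1 + ‖u‖) * Real.exp ‖u‖ + 1 := h1
      _ ≤ (2 + ‖u‖) * Real.exp ‖u‖ := by linarith
      _ ≤ (3 * ‖u‖ ^ 2) * Real.exp ‖u‖ := by gcongr; linarith
      _ = _ := by ring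

theorem tendsto_tprod_genus_one {y : ℕ → ℕ → ℝ} {x : ℕ → ℝ} {M : ℝ}
    (hy0 : ∀ n j, 0 ≤ y n j) (hyM : ∀ n j, y n j ≤ M / (j + 1))
    (hyx : ∀ j, Tendsto (fun n => y n j) atTop (𝓝 (x j))) (z : ℂ) :
    Tendsto (fun n => ∏' j, (1 - y n j * z) * Complex.exp (y n j * z)) atTop
      (𝓝 (∏' j, (1 - x j * z) * Complex.exp (x j * z))) := by
  have hM0 : 0 ≤ M := by simpa using (hy0 0 0).trans (hyM 0 0)
  have hsum : Summable fun j : ℕ =>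
      3 * Real.exp (M * ‖z‖) * (M * ‖z‖) ^ 2 * (1 / ((j : ℝ) + 1) ^ 2) := by
    apply Summable.mul_left
    exact_mod_cast (summable_nat_add_iff 1).2 (Real.summable_one_div_nat_pow.2 one_lt_two)
  have key := tendsto_tprod_one_add_of_dominated_convergence (𝓕 := atTop)
    (f := fun n j => (1 - y n j * z) * Complex.exp (y n j * z) - 1)
    (g := fun j => (1 - x j * z) * Complex.exp (x j * z) - 1) hsum
    (fun j => ?_) (Eventually.of_forall fun n j => ?_)
  · simpa using key
  · have h : Tendsto (fun n => (y n j : ℂ)) atTop (𝓝 (x j)) :=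
      (Complex.continuous_ofReal.tendsto _).comp (hyx j)
    have hz := h.mul_const z
    exact ((tendsto_const_nhds.sub hz).mul
      ((Complex.continuous_exp.tendsto _).comp hz)).sub_const 1
  · have hn : ‖(y n j : ℂ) * z‖ = y n j * ‖z‖ := by
      rw [norm_mul, Complex.norm_real, Real.norm_of_nonneg (hy0 n j)]
    refine (norm_one_sub_mul_exp_sub_one_le _).trans ?_
    rw [hn]
    have h1 : y n j * ‖z‖ ≤ M * ‖z‖ := by
      gcongr
      exact (hyM n j).trans (div_le_self hM0 (by linarith [j.cast_nonneg (α := ℝ)]))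
    have h2 : (y n j * ‖z‖) ^ 2 ≤ (M * ‖z‖) ^ 2 * (1 / ((j : ℝ) + 1) ^ 2) := by
      have : (M * ‖z‖) ^ 2 * (1 / ((j : ℝ) + 1) ^ 2) = (M / (j + 1) * ‖z‖) ^ 2 := by
        field_simp
      rw [this]
      have := hy0 n j
      gcongr
      exact hyM n j
    rw [mul_assoc (3 * Real.exp (M * ‖z‖))]
    gcongr

theorem multipliable_one_sub_mul {d : ℕ → ℝ} (hd : Summable d) (z : ℂ) :
    Multipliable fun j => 1 - (d j : ℂ) * z := by
  have h : Summable fun j => ‖-((d j : ℂ) * z)‖ := by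
    refine (hd.abs.mul_right ‖z‖).congr fun j => ?_
    rw [norm_neg, norm_mul, Complex.norm_real, Real.norm_eq_abs]
  simpa [sub_eq_add_neg] using multipliable_one_add_of_summable h

theorem tprod_genus_one_eq {x : ℕ → ℝ} (hx : Summable x) (z : ℂ) :
    ∏' j, (1 - x j * z) * Complex.exp (x j * z) =
      (∏' j, (1 - x j * z)) * Complex.exp (((∑' j, x j : ℝ) : ℂ) * z) := by
  have hs : HasSum (fun j => (x j : ℂ) * z) (((∑' j, x j : ℝ) : ℂ) * z) :=
    (Complex.hasSum_ofReal.2 hx.hasSum).mul_right z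
  exact ((multipliable_one_sub_mul hx z).hasProd.mul hs.cexp).tprod_eq

/-- Pointwise limits of polynomials `∏ (1 - y w) * R`, with `y ≥ 0` of bounded sum and `R` of
bounded degree and bounded coefficients. -/
theorem exists_limit_form {B : ℕ} {t M : ℝ} {c : ℕ → ℝ} {Y : ℕ → Multiset ℝ} {R : ℕ → ℝ[X]}
    {G : ℂ → ℂ} (hY : ∀ n, ∀ y ∈ Y n, 0 ≤ y ∧ y * t ≤ 1) (hYM : ∀ n, (Y n).sum ≤ M)
    (hRB : ∀ n, (R n).natDegree ≤ B) (hRc : ∀ n k, |(R n).coeff k| ≤ c k)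
    (hG : ∀ w, Tendsto (fun n => ((Y n).map fun y : ℝ => 1 - (y : ℂ) * w).prod * polyFun (R n) w)
      atTop (𝓝 (G w))) :
    ∃ (x : ℕ → ℝ) (α : ℝ) (Q : ℝ[X]), (∀ j, 0 ≤ x j) ∧ (∀ j, x j * t ≤ 1) ∧ Summable x ∧ 0 ≤ α ∧
      ∀ w, G w = polyFun Q w * Complex.exp (-α * w) * ∏' j, (1 - x j * w) := by
  choose y hanti hy0 hyY N hN hsum hprod using fun n =>
    exists_antitone_enumeration (Y n) fun y hy => (hY n y hy).1
  have hpart : ∀ n m, ∑ j ∈ Finset.range m, y n j ≤ (Y n).sum := fun n m => by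
    rw [← hsum]
    rcases le_total m (N n) with h | h
    · exact Finset.sum_le_sum_of_subset_of_nonneg (Finset.range_mono h) fun j _ _ => hy0 n j
    · refine (Finset.sum_subset (Finset.range_mono h) fun j _ hj => hN n j ?_).ge
      simpa using hj
  have hyM : ∀ n j, y n j ≤ M / (j + 1) := fun n =>
    le_div_of_antitone (hanti n) fun m => (hpart n m).trans (hYM n)
  have hS0 : ∀ n, 0 ≤ (Y n).sum := fun n => Multiset.sum_nonneg fun y hy => (hY n y hy).1
  have hcomp : IsCompact ((Set.univ.pi fun j : ℕ => Set.Icc (0 : ℝ) (M / (j + 1))) ×ˢ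
      Set.Icc (0 : ℝ) M ×ˢ (Set.univ.pi fun k : ℕ => Set.Icc (-c k) (c k))) :=
    (isCompact_univ_pi fun _ => isCompact_Icc).prod
      (isCompact_Icc.prod (isCompact_univ_pi fun _ => isCompact_Icc))
  obtain ⟨⟨x, S, q⟩, -, φ, hφ, hlim⟩ := hcomp.tendsto_subseq
    (x := fun n => (y n, (Y n).sum, fun k => (R n).coeff k)) fun n =>
      ⟨fun j _ => ⟨hy0 n j, hyM n j⟩, ⟨hS0 n, hYM n⟩, fun k _ => abs_le.1 (hRc n k)⟩
  have hx : ∀ j, Tendsto (fun n => y (φ n) j) atTop (𝓝 (x j)) :=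
    tendsto_pi_nhds.1 (hlim.fst_nhds)
  have hS : Tendsto (fun n => (Y (φ n)).sum) atTop (𝓝 S) := hlim.snd_nhds.fst_nhds
  have hq : ∀ k, Tendsto (fun n => (R (φ n)).coeff k) atTop (𝓝 (q k)) :=
    tendsto_pi_nhds.1 (hlim.snd_nhds.snd_nhds)
  have hx0 : ∀ j, 0 ≤ x j := fun j => ge_of_tendsto' (hx j) fun n => hy0 _ j
  have hxt : ∀ j, x j * t ≤ 1 := fun j => le_of_tendsto' ((hx j).mul_const t) fun n =>
    (hyY (φ n) j).elim (fun h => by rw [h]; simp) fun h => (hY _ _ h).2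
  have hxS : ∀ m, ∑ j ∈ Finset.range m, x j ≤ S := fun m =>
    le_of_tendsto_of_tendsto' (tendsto_finsetSum _ fun j _ => hx j) hS fun n => hpart _ m
  have hxsum : Summable x := summable_of_sum_range_le hx0 hxS
  set Q : ℝ[X] := ∑ k ∈ Finset.range (B + 1), monomial k (q k) with hQ
  have hRQ : ∀ w, Tendsto (fun n => polyFun (R (φ n)) w) atTop (𝓝 (polyFun Q w)) := fun w => by
    have h1 : polyFun Q w = ∑ k ∈ Finset.range (B + 1), (q k : ℂ) * w ^ k := by
      rw [polyFun, hQ, map_sum]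
      simp [aeval_monomial]
    have h2 : ∀ n, polyFun (R n) w =
        ∑ k ∈ Finset.range (B + 1), ((R n).coeff k : ℂ) * w ^ k := fun n => by
      rw [polyFun, aeval_eq_sum_range' (Nat.lt_succ_of_le (hRB n))]
      simp
    rw [h1]
    simp only [h2]
    exact tendsto_finsetSum _ fun k _ =>
      (((Complex.continuous_ofReal.tendsto _).comp (hq k)).mul_const _)
  refine ⟨x, S - ∑' j, x j, Q, hx0, hxt, hxsum,
    sub_nonneg.2 (Real.tsum_le_of_sum_range_le hx0 hxS), fun w => ?_⟩
  have hfin : ∀ n, ((Y n).map fun y : ℝ => 1 - (y : ℂ) * w).prod =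
      Complex.exp (-((Y n).sum : ℂ) * w) *
        ∏' j, (1 - y n j * w) * Complex.exp (y n j * w) := fun n => by
    rw [tprod_eq_prod (s := Finset.range (N n)) fun j hj => by
      rw [hN n j (by simpa using hj)]; simp]
    rw [Finset.prod_mul_distrib, ← Complex.exp_sum, ← Finset.sum_mul, ← Complex.ofReal_sum, hsum,
      hprod n fun y => 1 - (y : ℂ) * w, mul_left_comm, ← Complex.exp_add]
    simp
  have hlimw := ((((Complex.continuous_exp.tendsto _).comp
    ((((Complex.continuous_ofReal.tendsto _).comp hS).neg).mul_const w)).mul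
    (tendsto_tprod_genus_one (fun n => hy0 (φ n)) (fun n => hyM (φ n)) hx w)).mul (hRQ w))
  have huniq := tendsto_nhds_unique (((hG w).comp hφ.tendsto_atTop).congr fun n => by
    simp only [Function.comp_apply, hfin]) hlimw
  rw [huniq, tprod_genus_one_eq hxsum]
  have : Complex.exp (-((S - ∑' j, x j : ℝ) : ℂ) * w) =
      Complex.exp (-(S : ℂ) * w) * Complex.exp (((∑' j, x j : ℝ) : ℂ) * w) := by
    rw [← Complex.exp_add]
    push_cast
    ring_nf
  rw [this]
  ring

theorem differentiable_tprod_one_sub_mul {d : ℕ → ℝ} (hd : Summable d) :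
    Differentiable ℂ fun z : ℂ => ∏' j, (1 - (d j : ℂ) * z) := by
  intro z
  have hz : z ∈ Metric.ball (0 : ℂ) (‖z‖ + 1) := by simp
  have h := Summable.hasProdLocallyUniformlyOn_one_add (f := fun j (z : ℂ) => -((d j : ℂ) * z))
    (K := Metric.ball (0 : ℂ) (‖z‖ + 1)) Metric.isOpen_ball (hd.abs.mul_right (‖z‖ + 1))
    (Eventually.of_forall fun j w hw => by
      rw [norm_neg, norm_mul, Complex.norm_real, Real.norm_eq_abs]
      gcongr
      exact (mem_ball_zero_iff.1 hw).le) fun j => by fun_prop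
  have h2 := h.differentiableOn (.of_forall fun s => by
    simpa [Finset.prod_fn] using DifferentiableOn.finsetProd (fun _ _ ↦ by fun_prop))
    Metric.isOpen_ball
  simpa [sub_eq_add_neg] using h2.differentiableAt (Metric.isOpen_ball.mem_nhds hz)

theorem ofReal_tprod_of_multipliable {ι : Type*} {a : ι → ℝ} (ha : Multipliable a) :
    ((∏' j, a j : ℝ) : ℂ) = ∏' j, (a j : ℂ) :=
  ha.map_tprod Complex.ofRealHom Complex.continuous_ofReal

/-- The functions of `LP(S₀)`, with the zeros given through their reciprocals. -/
theorem mem_LPHalfLine_of_summable (c : ℝ) (m : ℕ) {α : ℝ} (hα : 0 ≤ α) {d : ℕ → ℝ}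
    (hd0 : ∀ j, 0 ≤ d j) (hd : Summable d) :
    (fun z : ℂ => c * z ^ m * Complex.exp (-α * z) * ∏' j, (1 - (d j : ℂ) * z)) ∈ LPHalfLine := by
  refine ⟨⟨?_, fun x => ?_⟩, c, m, α, {j : ℕ // d j ≠ 0}, inferInstance, fun j => (d j)⁻¹, hα,
    fun j => inv_pos.2 (lt_of_le_of_ne (hd0 j) j.2.symm), ?_, fun z => ?_⟩
  · have := differentiable_tprod_one_sub_mul hd
    fun_prop
  · have hm : Multipliable fun j => 1 - d j * x := by
      have h : Summable fun j => ‖-(d j * x)‖ := by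
        simpa using hd.abs.mul_right |x|
      simpa [sub_eq_add_neg] using multipliable_one_add_of_summable h
    have h1 : ∏' j, (1 - (d j : ℂ) * x) = ((∏' j, (1 - d j * x) : ℝ) : ℂ) := by
      rw [ofReal_tprod_of_multipliable hm]
      push_cast
      rfl
    have h2 : (c : ℂ) * (x : ℂ) ^ m * Complex.exp (-α * x) * ∏' j, (1 - (d j : ℂ) * x) =
        ((c * x ^ m * Real.exp (-α * x) * ∏' j, (1 - d j * x) : ℝ) : ℂ) := by
      rw [h1]; push_cast; rfl
    simp only [h2, Complex.ofReal_im]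
  · simp only [inv_inv]
    exact hd.subtype _
  · have h := tprod_subtype_eq_of_mulSupport_subset (s := {j | d j ≠ 0})
      (f := fun j => 1 - (d j : ℂ) * z) fun j hj hdj => hj (by
        simp [show d j = 0 from not_not.1 (by simpa using hdj)])
    simp only
    rw [← h]
    congr 1
    refine tprod_congr fun j => ?_
    push_cast
    rw [div_inv_eq_mul, mul_comm]

theorem tprod_one_sub_shift {x : ℕ → ℝ} {t : ℝ} (ht : 0 < t) (hx0 : ∀ j, 0 ≤ x j)
    (hxt : ∀ j, x j * t ≤ 1) (hx : Summable x) :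
    ∃ (c : ℝ) (m : ℕ) (d : ℕ → ℝ), (∀ j, 0 ≤ d j) ∧ Summable d ∧
      ∀ z : ℂ, ∏' j, (1 - x j * (z + t)) = c * z ^ m * ∏' j, (1 - (d j : ℂ) * z) := by
  classical
  have hev : ∀ᶠ j in cofinite, x j * t ≤ 1 / 2 := by
    have : Tendsto (fun j => x j * t) cofinite (𝓝 0) := by
      simpa using hx.tendsto_cofinite_zero.mul_const t
    exact (this.eventually (gt_mem_nhds one_half_pos)).mono fun j hj => hj.le
  have hfin : {j | x j * t = 1}.Finite := by
    refine Set.Finite.subset hev fun j hj hcon => ?_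
    have : x j * t = 1 := hj
    have : x j * t ≤ 1 / 2 := hcon
    linarith
  set d : ℕ → ℝ := fun j => x j / (1 - x j * t) with hd
  set A : ℕ → ℝ := fun j => if x j * t = 1 then -t⁻¹ else 1 - x j * t with hA
  have hdsum : Summable d := by
    refine (hx.mul_left 2).of_norm_bounded_eventually (hev.mono fun j hj => ?_)
    rw [Real.norm_of_nonneg (div_nonneg (hx0 j) (by linarith)), div_le_iff₀ (by linarith)]
    nlinarith [hx0 j]
  have hAm : Multipliable A := by
    have h : Summable fun j => ‖A j - 1‖ := by
      refine (hx.mul_left t).of_norm_bounded_eventually ?_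
      filter_upwards [hev] with j hj
      rw [norm_norm, hA]
      simp only [show x j * t ≠ 1 by intro h; linarith, if_false]
      rw [sub_sub_cancel_left, norm_neg, Real.norm_of_nonneg (mul_nonneg (hx0 j) ht.le), mul_comm]
    simpa using multipliable_one_add_of_summable h
  refine ⟨∏' j, A j, hfin.toFinset.card, d, fun j => div_nonneg (hx0 j) (by linarith [hxt j]),
    hdsum, fun z => ?_⟩
  have hE : HasProd (fun j => if x j * t = 1 then z else 1) (z ^ hfin.toFinset.card) := by
    have h : HasProd (fun j => if x j * t = 1 then z else 1)
        (∏ j ∈ hfin.toFinset, if x j * t = 1 then z else 1) :=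
      hasProd_prod_of_ne_finset_one fun j hj => by
        rw [if_neg]; simpa using hj
    rwa [Finset.prod_congr rfl (g := fun _ => z) fun j hj => by
      rw [if_pos]; simpa using hj, Finset.prod_const] at h
  have hAc : HasProd (fun j => (A j : ℂ)) ((∏' j, A j : ℝ) : ℂ) :=
    hAm.hasProd.map Complex.ofRealHom Complex.continuous_ofReal
  rw [← ((hAc.mul hE).mul (multipliable_one_sub_mul hdsum z).hasProd).tprod_eq]
  refine tprod_congr fun j => ?_
  have htc : (t : ℂ) ≠ 0 := by exact_mod_cast ht.ne'
  by_cases h : x j * t = 1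
  · have hxj : x j = t⁻¹ := eq_inv_of_mul_eq_one_left h
    simp only [hA, hd, h, if_true, sub_self, div_zero]
    rw [hxj]
    push_cast
    field_simp
    ring
  · have h' : (1 - (x j : ℂ) * t) ≠ 0 := by
      intro h0
      apply h
      have : ((1 - x j * t : ℝ) : ℂ) = 0 := by push_cast; exact h0
      linarith [Complex.ofReal_eq_zero.1 this]
    simp only [hA, hd, h, if_false]
    push_cast
    field_simp
    ring

theorem exists_neg_ne_zero_of_represents {g : PowerSeries ℂ} {F : ℂ → ℂ} (hF : Represents g F)
    (hne : ∃ k, PowerSeries.coeff k g ≠ 0) : ∃ t : ℝ, 0 < t ∧ F (-t) ≠ 0 := by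
  set p := FormalMultilinearSeries.ofScalars ℂ fun k => PowerSeries.coeff k g with hp
  have hcoeff : ∀ k, p.coeff k = PowerSeries.coeff k g := fun k => by
    simp [hp, FormalMultilinearSeries.coeff_ofScalars]
  have hps : HasFPowerSeriesAt F p 0 := by
    rw [hasFPowerSeriesAt_iff]
    refine Eventually.of_forall fun z => ?_
    simpa [hcoeff, mul_comm] using hF z
  rcases hps.analyticAt.eventually_eq_zero_or_eventually_ne_zero with h | h
  · obtain ⟨k, hk⟩ := hne
    have hp0 : p = 0 := HasFPowerSeriesAt.eq_zero (hps.congr h)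
    exact (hk (by rw [← hcoeff k, hp0]; rfl)).elim
  · have htend : Tendsto (fun t : ℝ => -(t : ℂ)) (𝓝[>] 0) (𝓝[≠] 0) := by
      refine tendsto_nhdsWithin_iff.2 ⟨?_, ?_⟩
      · have : Continuous fun t : ℝ => -(t : ℂ) := by fun_prop
        simpa using (this.tendsto 0).mono_left nhdsWithin_le_nhds
      · filter_upwards [self_mem_nhdsWithin] with t ht
        have : t ≠ 0 := ne_of_gt ht
        simpa using this
    obtain ⟨t, h1, h2⟩ := ((htend.eventually h).and self_mem_nhdsWithin).exists
    exact ⟨t, h2, h1⟩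

theorem norm_polyFun_le {p : ℝ[X]} {A T : ℝ} (hA : ∀ k, |p.coeff k| ≤ A * (T ^ k / k.factorial))
    {ρ : ℝ} {z : ℂ} (hz : ‖z‖ ≤ ρ) :
    ‖polyFun p z‖ ≤ ∑' k : ℕ, A * (T ^ k / k.factorial) * ρ ^ k := by
  rw [← (hasSum_polyFun p z).tsum_eq]
  refine tsum_of_norm_bounded (summable_coeff_bound A T ρ).hasSum fun k => ?_
  rw [norm_mul, norm_pow, Complex.norm_real, Real.norm_eq_abs]
  have := (abs_nonneg _).trans (hA k)
  gcongr
  exact hA k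

theorem abs_coeff_le_of_forall_mem_sphere {p : ℝ[X]} {C : ℝ}
    (hC : ∀ z ∈ Metric.sphere (0 : ℂ) 1, ‖polyFun p z‖ ≤ C) (k : ℕ) : |p.coeff k| ≤ C := by
  have hd : Differentiable ℂ (polyFun p) := fun z => p.differentiableAt_aeval
  have h := Complex.norm_iteratedDeriv_le_of_forall_mem_sphere_norm_le k one_pos
    hd.diffContOnCl hC
  have h2 := congrArg norm (inv_factorial_mul_iteratedDeriv_polyFun p k)
  rw [Complex.norm_real, Real.norm_eq_abs, norm_mul, norm_div, norm_one, Complex.norm_natCast] at h2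
  rw [one_pow, div_one] at h
  have hk : (0 : ℝ) < k.factorial := by positivity
  rw [← h2, div_mul_eq_mul_div, one_mul, div_le_iff₀ hk, mul_comm]
  exact h

theorem polyFun_comp_X_sub_C (p : ℝ[X]) (t : ℝ) (z : ℂ) :
    polyFun (p.comp (X - C t)) z = polyFun p (z - t) := by
  simp [polyFun, aeval_comp]

theorem HasNonnegFactor.comp_X_sub_C {B : ℕ} {p : ℝ[X]} (h : HasNonnegFactor B p) (t : ℝ) :
    ∃ (s : Multiset ℝ) (Q : ℝ[X]), (∀ a ∈ s, t ≤ a) ∧ Q.natDegree ≤ B ∧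
      p.comp (X - C t) = (s.map fun a => X - C a).prod * Q := by
  obtain ⟨s, Q, hs, hQ, rfl⟩ := h
  refine ⟨s.map fun a => a + t, Q.comp (X - C t), fun a ha => ?_, ?_, ?_⟩
  · obtain ⟨b, hb, rfl⟩ := Multiset.mem_map.1 ha
    linarith [hs b hb]
  · rwa [natDegree_comp, natDegree_X_sub_C, mul_one]
  · rw [mul_comp, multiset_prod_comp, Multiset.map_map, Multiset.map_map]
    congr 3
    ext1 a
    simp only [Function.comp_apply, sub_comp, X_comp, C_comp, C_add]
    ring

theorem polyFun_prod_one_sub_mul (Y : Multiset ℝ) (R : ℝ[X]) (w : ℂ) :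
    polyFun ((Y.map fun y => 1 - C y * X).prod * R) w =
      (Y.map fun y : ℝ => 1 - (y : ℂ) * w).prod * polyFun R w := by
  rw [polyFun, map_mul, map_multiset_prod, Multiset.map_map]
  simp [polyFun]

theorem isRealEntire_polyFun (p : ℝ[X]) : IsRealEntire (polyFun p) :=
  ⟨fun _ => p.differentiableAt_aeval, fun x => by
    have : polyFun p x = ((p.eval x : ℝ) : ℂ) := by
      simpa [polyFun] using aeval_algebraMap_apply ℂ x p
    rw [this, Complex.ofReal_im]⟩

theorem polyFun_mul_mem_LPHalfLineStar (P : ℝ[X]) {g : ℂ → ℂ} (hg : g ∈ LPHalfLine) :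
    (fun z => polyFun P z * g z) ∈ LPHalfLineStar :=
  ⟨⟨(isRealEntire_polyFun P).1.mul hg.1.1, fun x => by
    simp [Complex.mul_im, (isRealEntire_polyFun P).2 x, hg.1.2 x]⟩, P, g, hg, fun _ => rfl⟩

/-- Pointwise limits of polynomials with few zeros outside `[0, ∞)` and locally bounded
coefficients belong to `LP(S₀)*`. -/
theorem mem_LPHalfLineStar_of_tendsto {B : ℕ} {f : ℕ → ℝ[X]} {F : ℂ → ℂ} {A T t : ℝ}
    (hf : ∀ n, HasNonnegFactor B (f n))
    (hA : ∀ᶠ n in atTop, ∀ k, |(f n).coeff k| ≤ A * (T ^ k / k.factorial))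
    (hF : ∀ z, Tendsto (fun n => polyFun (f n) z) atTop (𝓝 (F z)))
    (ht : 0 < t) (hFt : F (-t) ≠ 0) : F ∈ LPHalfLineStar := by
  set D : ℝ := ∑' k : ℕ, A * (T ^ k / k.factorial) * (1 + t) ^ k
  set δ := ‖F (-t)‖ / 2
  have hδ : 0 < δ := half_pos (norm_pos_iff.2 hFt)
  set p : ℕ → ℝ[X] := fun n => (f n).comp (X - C t) with hp
  have hp0 : ∀ n, |(p n).coeff 0| = ‖polyFun (f n) (-t)‖ := fun n => by
    have h : ((p n).coeff 0 : ℂ) = polyFun (f n) (-t) := by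
      have h1 := polyFun_comp_X_sub_C (f n) t 0
      rw [zero_sub] at h1
      rw [← h1, polyFun, ← coeff_zero_eq_aeval_zero']
      rfl
    rw [← h, Complex.norm_real, Real.norm_eq_abs]
  have hlow : ∀ᶠ n in atTop, δ ≤ |(p n).coeff 0| := by
    filter_upwards [(hF (-t)).norm.eventually (lt_mem_nhds (half_lt_self (norm_pos_iff.2 hFt)))]
      with n hn
    rw [hp0]
    exact hn.le
  have hpD : ∀ᶠ n in atTop, ∀ k, |(p n).coeff k| ≤ D := by
    filter_upwards [hA] with n hn k
    refine abs_coeff_le_of_forall_mem_sphere (fun z hz => ?_) k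
    rw [hp, polyFun_comp_X_sub_C]
    refine norm_polyFun_le hn ((norm_sub_le _ _).trans ?_)
    rw [mem_sphere_zero_iff_norm.1 hz, Complex.norm_real, Real.norm_of_nonneg ht.le]
  obtain ⟨M, hM0, hM⟩ := exists_normalized_factorization B fun _ => D / δ
  obtain ⟨n₀, hn₀⟩ := eventually_atTop.1 (hlow.and hpD)
  have hfac : ∀ n, ∃ (Y : Multiset ℝ) (R : ℝ[X]), (∀ y ∈ Y, 0 ≤ y ∧ y * t ≤ 1) ∧ Y.sum ≤ M ∧
      R.natDegree ≤ B ∧ p (n + n₀) = (Y.map fun y => 1 - C y * X).prod * R ∧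
      ∀ k, |R.coeff k| ≤ D * (M ^ k / k.factorial) := fun n => by
    obtain ⟨h1, h2⟩ := hn₀ (n + n₀) (by omega)
    obtain ⟨s, Q, hs, hQ, hpQ⟩ := (hf (n + n₀)).comp_X_sub_C t
    obtain ⟨Y, R, hY, hYM, hR, hYR, hRc, -⟩ := hM t s Q (p (n + n₀)) ht.le hs hQ hpQ
      (abs_pos.1 (hδ.trans_le h1)) fun k => by
        have hD0 := (abs_nonneg _).trans (h2 0)
        refine (h2 k).trans ?_
        rw [div_mul_eq_mul_div, le_div_iff₀ hδ]
        gcongr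
    refine ⟨Y, R, hY, hYM, hR, hYR, fun k => (hRc k).trans ?_⟩
    gcongr
    exact h2 0
  choose Y R hY hYM hR hYR hRc using hfac
  obtain ⟨x, α, Q, hx0, hxt, hx, hα, hG⟩ := exists_limit_form (G := fun w => F (w - t))
    hY hYM hR hRc fun w => by
      have h := (tendsto_add_atTop_iff_nat n₀).2 (hF (w - t))
      refine h.congr fun n => ?_
      rw [← polyFun_prod_one_sub_mul, ← hYR, hp, polyFun_comp_X_sub_C]
  obtain ⟨c, m, d, hd0, hd, hshift⟩ := tprod_one_sub_shift ht hx0 hxt hx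
  have hFeq : F = fun z => polyFun (Q.comp (X - C (-t))) z *
      (((c * Real.exp (-α * t) : ℝ) : ℂ) * z ^ m * Complex.exp (-α * z) *
        ∏' j, (1 - (d j : ℂ) * z)) := by
    ext z
    have h := hG (z + t)
    simp only [add_sub_cancel_right, hshift] at h
    rw [h, polyFun_comp_X_sub_C, mul_add, Complex.exp_add]
    push_cast
    rw [sub_neg_eq_add]
    ring
  rw [hFeq]
  exact polyFun_mul_mem_LPHalfLineStar _ (mem_LPHalfLine_of_summable _ m hα hd0 hd)

theorem theorem3p4 (f : ℕ → ℝ[X]) (g : PowerSeries ℂ)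
    (hweak : ConvergesWeakly (fun n => polyFun (f n)) g)
    (hne : ∃ k : ℕ, PowerSeries.coeff k g ≠ 0)
    (hbdd : ∃ B : ℕ, ∀ n : ℕ, zeroCount (f n) halfLineᶜ ≤ B) :
    ∃ F : ℂ → ℂ, Represents g F ∧ F ∈ LPHalfLineStar ∧
      ConvergesStrongly (fun n => polyFun (f n)) F := by
  obtain ⟨B, hB⟩ := hbdd
  have hf : ∀ n, HasNonnegFactor B (f n) := fun n => hasNonnegFactor_of_zeroCount_le (hB n)
  have hcoeff : ∀ k, Tendsto (fun n => ((f n).coeff k : ℂ)) atTop (𝓝 (PowerSeries.coeff k g)) :=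
    fun k => (hweak k).congr fun n => inv_factorial_mul_iteratedDeriv_polyFun (f n) k
  have hb : ∀ k, Tendsto (fun n => (f n).coeff k) atTop (𝓝 (PowerSeries.coeff k g).re) :=
    fun k => (Complex.continuous_re.tendsto _).comp (hcoeff k)
  have hbg : ∀ k, ((PowerSeries.coeff k g).re : ℂ) = PowerSeries.coeff k g := fun k =>
    tendsto_nhds_unique ((Complex.continuous_ofReal.tendsto _).comp (hb k)) (hcoeff k)
  have hne' : ∃ k, (PowerSeries.coeff k g).re ≠ 0 := by
    obtain ⟨k, hk⟩ := hne
    exact ⟨k, fun h => hk (by rw [← hbg, h, Complex.ofReal_zero])⟩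
  obtain ⟨A, T, -, -, hAT⟩ := exists_coeff_bound hf hb hne'
  have hbA : ∀ k, |(PowerSeries.coeff k g).re| ≤ A * (T ^ k / k.factorial) := fun k =>
    le_of_tendsto (hb k).abs (hAT.mono fun n hn => hn k)
  have hstrong := convergesStrongly_of_coeff_bound hb hAT
  have hrep : Represents g fun z => ∑' k, ((PowerSeries.coeff k g).re : ℂ) * z ^ k := fun z => by
    simpa only [hbg] using (summable_of_coeff_bound hbA z).hasSum
  obtain ⟨t, ht, hFt⟩ := exists_neg_ne_zero_of_represents hrep hne
  exact ⟨_, hrep, mem_LPHalfLineStar_of_tendsto hf hAT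
    (fun z => (hstrong {z} isCompact_singleton).tendsto_at rfl) ht hFt, hstrong⟩
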